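/- Let $K$ be a field of characteristic zero (for instance $\mathbb{Q}$) and $n\ge 0$. Let $\mathsf{lie}_n$ and $\mathsf{ass}_n$ be the free Lie algebra and the free associative algebra over $K$ on $x_1,\dots,x_n$, with $\mathsf{lie}_n\subset\mathsf{ass}_n$ in the natural way; let $\mathsf{tr}_n=\mathsf{ass}_n/[\mathsf{ass}_n,\mathsf{ass}_n]$, where $[\mathsf{ass}_n,\mathsf{ass}_n]$ is the linear span of the commutators, with projection $|\cdot|:\mathsf{ass}_n\to\mathsf{tr}_n$; put $x_0=x_1+\cdots+x_n$. For $\tilde u=(u_1,\dots,u_n)\in\mathsf{lie}_n^{\oplus n}$ let $u=\rho(\tilde u)$ be the derivation of $\mathsf{lie}_n$ with $u(x_i)=[x_i,u_i]$ for $i=1,\dots,n$, and let $\mathrm{div}(\tilde u)=\sum_{i=1}^n|x_i(\partial_iu_i)|\in\mathsf{tr}_n$, where $\partial_1a,\dots,\partial_na\in\mathsf{ass}_n$ are determined by $a=\sum_{i=1}^n(\partial_ia)x_i$ for $a\in\mathsf{lie}_n$. Let $\mathsf{sder}_n$ be the set of those $\tilde u$ with $u(x_0)=0$, and let $\mathsf{krv}_n$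 be the set of those $\tilde u\in\mathsf{sder}_n$ for which there are formal power series $f_0,\dots,f_n\in K[[s]]$ with $\mathrm{div}(\tilde u)=\sum_{i=0}^n|f_i(x_i)|$ (an identity in the degree completion of $\mathsf{tr}_n$). Let $\mu^f_{\mathrm{gr}}:\mathsf{ass}_n\to\mathsf{ass}_n$ be the linear map given on words in the generators $a_1,\dots,a_m\in\{x_1,\dots,x_n\}$ by $$\mu^f_{\mathrm{gr}}(a_1\cdots a_m)=-\sum_{j=1}^{m-1}a_1\cdots a_{j-1}\,\mathfrak z(a_j,a_{j+1})\,a_{j+2}\cdots a_m,\qquad \mathfrak z(x_i,x_j)=\delta_{ij}x_i .$$ Proposition. Let $\tilde u\in\mathsf{sder}_n$, let $u=\rho(\tilde u)$, and suppose that there is some $c\in\mathsf{ass}_n$ such that $\mu^f_{\mathrm{gr}}(u(x_i))=[x_i,c]$ for all $i=1,\dots,n$. Then $\tilde u\in\mathsf{krv}_n$. -/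

import Mathlib

/-! # Tangential derivations, divergence and the Kashiwara-Vergne Lie algebras

`K` is the ground field, `n` the number of generators. -/

noncomputable section

namespace KV

/-! ## Derivations of a free Lie algebra with prescribed values on the generators -/

/-- The Lie algebra `L ⊗ K[ε]/(ε²)`: pairs `(a, b)`, to be read as `a + ε b`. -/
@[ext] structure Dual (L : Type*) where
  /-- the constant part -/
  fst : L
  /-- the coefficient of `ε` -/
  snd : L

namespace Dual

/-- Pairs, as a plain type. -/
def toProd (L : Type*) : Dual L ≃ L × L where
  toFun a := (a.fst, a.snd)
  invFun a := ⟨a.1, a.2⟩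
  left_inv _ := rfl
  right_inv _ := rfl

instance (L : Type*) [LieRing L] : AddCommGroup (Dual L) := (toProd L).addCommGroup

instance (K L : Type*) [CommRing K] [LieRing L] [LieAlgebra K L] : Module K (Dual L) :=
  (toProd L).module K

instance (L : Type*) [LieRing L] : Bracket (Dual L) (Dual L) where
  bracket a b := ⟨⁅a.fst, b.fst⁆, ⁅a.fst, b.snd⁆ + ⁅a.snd, b.fst⁆⟩

theorem fst_add {L : Type*} [LieRing L] (a b : Dual L) : (a + b).fst = a.fst + b.fst := rfl

theorem snd_add {L : Type*} [LieRing L] (a b : Dual L) : (a + b).snd = a.snd + b.snd := rfl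

theorem fst_zero {L : Type*} [LieRing L] : (0 : Dual L).fst = 0 := rfl

theorem snd_zero {L : Type*} [LieRing L] : (0 : Dual L).snd = 0 := rfl

theorem fst_smul {K L : Type*} [CommRing K] [LieRing L] [LieAlgebra K L] (t : K) (a : Dual L) :
    (t • a).fst = t • a.fst := rfl

theorem snd_smul {K L : Type*} [CommRing K] [LieRing L] [LieAlgebra K L] (t : K) (a : Dual L) :
    (t • a).snd = t • a.snd := rfl

theorem fst_lie {L : Type*} [LieRing L] (a b : Dual L) : ⁅a, b⁆.fst = ⁅a.fst, b.fst⁆ := rfl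

theorem snd_lie {L : Type*} [LieRing L] (a b : Dual L) :
    ⁅a, b⁆.snd = ⁅a.fst, b.snd⁆ + ⁅a.snd, b.fst⁆ := rfl

instance (L : Type*) [LieRing L] : LieRing (Dual L) where
  add_lie a b c := by
    ext <;> simp only [fst_add, snd_add, fst_lie, snd_lie, add_lie]
    abel
  lie_add a b c := by
    ext <;> simp only [fst_add, snd_add, fst_lie, snd_lie, lie_add]
    abel
  lie_self a := by
    ext
    · simp only [fst_lie, fst_zero, lie_self]
    · simp only [snd_lie, snd_zero]
      rw [← lie_skew a.fst a.snd, neg_add_cancel]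
  leibniz_lie a b c := by
    ext <;> simp only [fst_add, snd_add, fst_lie, snd_lie, lie_add, add_lie, lie_lie]
    · abel
    · abel

instance (K L : Type*) [CommRing K] [LieRing L] [LieAlgebra K L] : LieAlgebra K (Dual L) where
  lie_smul t a b := by
    ext <;> simp only [fst_smul, snd_smul, fst_lie, snd_lie, lie_smul, smul_add]

/-- The constant part, as a Lie algebra homomorphism. -/
def fstHom (K L : Type*) [CommRing K] [LieRing L] [LieAlgebra K L] : Dual L →ₗ⁅K⁆ L where
  toFun a := a.fst
  map_add' _ _ := rfl
  map_smul' _ _ := rfl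
  map_lie' := rfl

/-- The coefficient of `ε`, as a linear map. -/
def sndLin (K L : Type*) [CommRing K] [LieRing L] [LieAlgebra K L] : Dual L →ₗ[K] L where
  toFun a := a.snd
  map_add' _ _ := rfl
  map_smul' _ _ := rfl

end Dual

variable (K : Type*) [Field K] (n : ℕ)

/-- `lie_n`: the free Lie algebra on `x_1, …, x_n` (here indexed by `Fin n`). -/
abbrev Lie : Type _ := FreeLieAlgebra K (Fin n)

/-- `ass_n`: the free associative algebra on `x_1, …, x_n`. -/
abbrev Ass : Type _ := FreeAlgebra K (Fin n)

/-- The Lie homomorphism `a ↦ a + ε D a` attached to the derivation `D` with `D x_i = v_i`. -/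
def derHom (v : Fin n → Lie K n) : Lie K n →ₗ⁅K⁆ Dual (Lie K n) :=
  FreeLieAlgebra.lift K fun i => ⟨FreeLieAlgebra.of K i, v i⟩

theorem derHom_fst (v : Fin n → Lie K n) (a : Lie K n) : (derHom K n v a).fst = a := by
  have h : (Dual.fstHom K (Lie K n)).comp (derHom K n v) = LieHom.id := by
    ext i
    simp only [derHom, LieHom.comp_apply, FreeLieAlgebra.lift_of_apply]
    rfl
  exact LieHom.congr_fun h a

/-- The derivation `D` of `lie_n` with `D x_i = v_i` for all `i`. -/
def der (v : Fin n → Lie K n) : LieDerivation K (Lie K n) (Lie K n) where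
  toLinearMap := (Dual.sndLin K (Lie K n)).comp (derHom K n v : Lie K n →ₗ[K] Dual (Lie K n))
  leibniz' a b := by
    change (derHom K n v ⁅a, b⁆).snd = ⁅a, (derHom K n v b).snd⁆ - ⁅b, (derHom K n v a).snd⁆
    rw [LieHom.map_lie, Dual.snd_lie, derHom_fst, derHom_fst, sub_eq_add_neg, lie_skew]

theorem der_of (v : Fin n → Lie K n) (i : Fin n) : der K n v (FreeLieAlgebra.of K i) = v i := by
  change (derHom K n v (FreeLieAlgebra.of K i)).snd = v i
  simp [derHom]

/-- `tder_n`, the space of tangential derivations `ũ = (u_1, …, u_n)` with `u_i ∈ lie_n`. -/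
abbrev Tder : Type _ := Fin n → Lie K n

variable {K n}

/-- `ρ(ũ)`: the derivation of `lie_n` given by `x_i ↦ [x_i, u_i]`. -/
def rho (u : Tder K n) : LieDerivation K (Lie K n) (Lie K n) :=
  der K n fun i => ⁅FreeLieAlgebra.of K i, u i⁆

theorem rho_of (u : Tder K n) (i : Fin n) :
    rho u (FreeLieAlgebra.of K i) = ⁅FreeLieAlgebra.of K i, u i⁆ :=
  der_of K n _ i

variable (K n)

/-- `sder_n`: the tangential derivations with `ρ(ũ)(x_1 + ⋯ + x_n) = 0`. -/
def sder : Set (Tder K n) :=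
  {u | rho u (∑ i, FreeLieAlgebra.of K i) = 0}

/-! ## The free associative algebra -/

section
attribute [local instance] LieRing.ofAssociativeRing

/-- The natural Lie homomorphism `lie_n → ass_n` (commutator bracket on `ass_n`), `x_i ↦ x_i`. -/
def toAss : Lie K n →ₗ⁅K⁆ Ass K n := FreeLieAlgebra.lift K (FreeAlgebra.ι K)

end

variable {n}

/-- The generator `x_i` of `ass_n`. -/
abbrev x (i : Fin n) : Ass K n := FreeAlgebra.ι K i

/-- The word `x_{i_1} ⋯ x_{i_m}` of `ass_n`. -/
def word (l : List (Fin n)) : Ass K n := (l.map (x K)).prod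

variable {K}

/-- The linear map on `ass_n` with prescribed values on the basis of words. -/
def onWords {M : Type*} [AddCommGroup M] [Module K M] (f : List (Fin n) → M) : Ass K n →ₗ[K] M :=
  (FreeAlgebra.basisFreeMonoid K (Fin n)).constr K fun w => f w.toList

theorem basis_eq_word (w : FreeMonoid (Fin n)) :
    FreeAlgebra.basisFreeMonoid K (Fin n) w = word K w.toList := by
  simp [FreeAlgebra.basisFreeMonoid, FreeAlgebra.equivMonoidAlgebraFreeMonoid, word,
    FreeMonoid.lift_apply]

theorem onWords_word {M : Type*} [AddCommGroup M] [Module K M] (f : List (Fin n) → M)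
    (l : List (Fin n)) : onWords f (word K l) = f l := by
  have h := basis_eq_word (K := K) (FreeMonoid.ofList l)
  rw [FreeMonoid.toList_ofList] at h
  rw [← h, onWords, Module.Basis.constr_basis, FreeMonoid.toList_ofList]

theorem word_induction {P : Ass K n → Prop} (a : Ass K n) (hw : ∀ l, P (word K l)) (h0 : P 0)
    (hadd : ∀ a b, P a → P b → P (a + b)) (hsmul : ∀ (t : K) a, P a → P (t • a)) : P a := by
  have ha : a ∈ Submodule.span K (Set.range (FreeAlgebra.basisFreeMonoid K (Fin n))) := by
    rw [Module.Basis.span_eq]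
    trivial
  induction ha using Submodule.span_induction with
  | mem a h =>
    obtain ⟨w, rfl⟩ := h
    rw [basis_eq_word]
    exact hw _
  | zero => exact h0
  | add a b _ _ h1 h2 => exact hadd a b h1 h2
  | smul t a _ h => exact hsmul t a h

theorem word_mul (l m : List (Fin n)) : word K l * word K m = word K (l ++ m) := by
  simp [word]

/-- `∂_i`: removes a final letter `x_i` and kills the words that do not end in `x_i`, so that
`a = ∑ i, (∂_i a) x_i` for every `a` without constant term, in particular on `lie_n`. -/
def partialDeriv (i : Fin n) : Ass K n →ₗ[K] Ass K n :=
  onWords fun l => if l.getLast? = some i then word K l.dropLast else 0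

variable (K) in
/-- `𝔷(x_i, x_j) = δ_ij x_i`. -/
def frakz (i j : Fin n) : Ass K n := if i = j then x K i else 0

/-- `μ^f_gr`, of degree `-1`: on words,
`a_1 ⋯ a_m ↦ - ∑_{j=1}^{m-1} a_1 ⋯ a_{j-1} 𝔷(a_j, a_{j+1}) a_{j+2} ⋯ a_m`. -/
def muGr : Ass K n →ₗ[K] Ass K n :=
  onWords fun l => -∑ j : Fin (l.length - 1),
    word K (l.take j) * frakz K (l[j.1]'(by omega)) (l[j.1 + 1]'(by omega)) *
      word K (l.drop (j + 2))

/-! ## Cyclic words -/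

variable (K n)

/-- The linear span of all commutators in `ass_n`. -/
def commSpan : Submodule K (Ass K n) :=
  Submodule.span K {c | ∃ a b : Ass K n, c = a * b - b * a}

/-- `tr_n = ass_n / [ass_n, ass_n]`, the space of cyclic words. -/
abbrev Tr : Type _ := Ass K n ⧸ commSpan K n

variable {K n}

/-- The projection `| | : ass_n → tr_n`. -/
def tr : Ass K n →ₗ[K] Tr K n := (commSpan K n).mkQ

/-- The divergence `div(ũ) = ∑ i, |x_i (∂_i u_i)|`. -/
def divergence (u : Tder K n) : Tr K n :=
  ∑ i, tr (x K i * partialDeriv i (toAss K n (u i)))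

/-- The projection of `ass_n` to its homogeneous part of degree `k`. -/
def assComp (k : ℕ) : Ass K n →ₗ[K] Ass K n :=
  onWords fun l => if l.length = k then word K l else 0

theorem assComp_comm (k : ℕ) (a b : Ass K n) : assComp k (a * b - b * a) ∈ commSpan K n := by
  refine word_induction (P := fun a => assComp k (a * b - b * a) ∈ commSpan K n) a
    (fun l => ?_) (by simp) (fun a₁ a₂ h₁ h₂ => ?_) (fun t a h => ?_)
  · refine word_induction
      (P := fun b => assComp k (word K l * b - b * word K l) ∈ commSpan K n) b
      (fun m => ?_) (by simp) (fun b₁ b₂ h₁ h₂ => ?_) (fun t b h => ?_)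
    · rw [map_sub, word_mul, word_mul, assComp, onWords_word, onWords_word, List.length_append,
        List.length_append, add_comm m.length]
      split_ifs
      · rw [← word_mul, ← word_mul]
        exact Submodule.subset_span ⟨_, _, rfl⟩
      · simp
    · have e : word K l * (b₁ + b₂) - (b₁ + b₂) * word K l
          = (word K l * b₁ - b₁ * word K l) + (word K l * b₂ - b₂ * word K l) := by noncomm_ring
      rw [e, map_add]
      exact Submodule.add_mem _ h₁ h₂
    · rw [mul_smul_comm, smul_mul_assoc, ← smul_sub, map_smul]
      exact Submodule.smul_mem _ _ h
  · have e : (a₁ + a₂) * b - b * (a₁ + a₂) = (a₁ * b - b * a₁) + (a₂ * b - b * a₂) := by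
      noncomm_ring
    rw [e, map_add]
    exact Submodule.add_mem _ h₁ h₂
  · rw [mul_smul_comm, smul_mul_assoc, ← smul_sub, map_smul]
    exact Submodule.smul_mem _ _ h

/-- The projection of `tr_n` to its homogeneous part of degree `k`. -/
def trComp (k : ℕ) : Tr K n →ₗ[K] Tr K n :=
  (commSpan K n).mapQ (commSpan K n) (assComp k) (by
    refine Submodule.span_le.mpr ?_
    rintro _ ⟨a, b, rfl⟩
    exact assComp_comm k a b)

/-- The canonical map of `tr_n` to its degree completion `∏ k, (tr_n)_k`; an element of the
completion is written as the sequence of its homogeneous components. -/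
def toCompletion (t : Tr K n) : ℕ → Tr K n := fun k => trComp k t

/-- `|f(a)| = ∑ k, f_k |a^k|` in the degree completion of `tr_n`, for a power series
`f = ∑ k, f_k s^k` and an element `a` of degree one. -/
def trSeries (f : PowerSeries K) (a : Ass K n) : ℕ → Tr K n :=
  fun k => PowerSeries.coeff k f • tr (a ^ k)

variable (K n)

/-- The degree one elements `x_0, x_1, …, x_n` of `ass_n`, where `x_0 = x_1 + ⋯ + x_n`. -/
def xExt : Fin (n + 1) → Ass K n := Fin.cons (∑ i, x K i) (x K)

/-- The Kashiwara-Vergne Lie algebra `krv_n`: the special derivations `ũ` with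
`div(ũ) = ∑_{i=0}^n |f_i(x_i)|` for some formal power series `f_0, …, f_n`. -/
def krv : Set (Tder K n) :=
  {u | u ∈ sder K n ∧ ∃ f : Fin (n + 1) → PowerSeries K,
    toCompletion (divergence u) = ∑ i, trSeries (f i) (xExt K n i)}

end KV

end

/-!
Put `v = ∑ x_i u_i`. The hypothesis `u(x_0) = 0` says `v = ∑ u_i x_i`, so `v` is invariant under
cyclic rotation of words, and `u_i` is obtained from `v` by removing a letter `x_i` on either side.
Since `μ(a b) - μ(a) b - a μ(b)` only involves the two letters that meet at the junction, the
condition `μ(u(x_i)) = [x_i, c]` says that `μ(u_i) - ∂_i u_i - c` commutes with `x_i`, hence is a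
polynomial `p_i(x_i)`. Expanding `μ(v)` along the two expressions for `v` then shows that `c`
commutes with `x_0`, so `c = p_0(x_0)` and `μ(v) = ∑_{i ≥ 0} x_i p_i(x_i)`. Finally, contracting two
adjacent letters of a rotation invariant element gives the same cyclic word at every position, so
`|μ(v)|` is `-k` times the divergence in degree `k`, and the `f_i` are antiderivatives of the
`-p_i`.
-/

namespace KV

open Polynomial Filter

variable {K : Type*} [Field K] {n : ℕ}

theorem word_nil : word K ([] : List (Fin n)) = 1 := by
  simp [word]

theorem word_cons (i : Fin n) (l : List (Fin n)) : word K (i :: l) = x K i * word K l := by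
  simp [word]

theorem word_concat (l : List (Fin n)) (i : Fin n) : word K (l ++ [i]) = word K l * x K i := by
  simp [word]

theorem algebraMapInv_x (i : Fin n) : FreeAlgebra.algebraMapInv (x K i) = 0 := by
  simp [FreeAlgebra.algebraMapInv]

/-! ## Removing the first or the last letter -/

/-- The left analogue of `partialDeriv`: removes an initial letter `x_i` and kills the words that do
not begin with `x_i`. -/
noncomputable def leftDeriv (i : Fin n) : Ass K n →ₗ[K] Ass K n :=
  onWords fun l => if l.head? = some i then word K l.tail else 0

theorem leftDeriv_word (i : Fin n) (l : List (Fin n)) :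
    leftDeriv i (word K l) = if l.head? = some i then word K l.tail else 0 :=
  onWords_word _ _

theorem partialDeriv_word (i : Fin n) (l : List (Fin n)) :
    partialDeriv i (word K l) = if l.getLast? = some i then word K l.dropLast else 0 :=
  onWords_word _ _

theorem leftDeriv_one (i : Fin n) : leftDeriv i (1 : Ass K n) = 0 := by
  simp [← word_nil, leftDeriv_word]

theorem partialDeriv_one (i : Fin n) : partialDeriv i (1 : Ass K n) = 0 := by
  simp [← word_nil, partialDeriv_word]

theorem leftDeriv_x_mul (i j : Fin n) (a : Ass K n) :
    leftDeriv i (x K j * a) = if j = i then a else 0 := by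
  induction a using word_induction with
  | hw l => simp [← word_cons, leftDeriv_word]
  | h0 => simp
  | hadd a b ha hb => simp only [mul_add, map_add, ha, hb, ite_add_ite, add_zero]
  | hsmul t a ha => simp only [mul_smul_comm, map_smul, ha, smul_ite, smul_zero]

theorem partialDeriv_mul_x (i j : Fin n) (a : Ass K n) :
    partialDeriv i (a * x K j) = if j = i then a else 0 := by
  induction a using word_induction with
  | hw l => simp [← word_concat, partialDeriv_word]
  | h0 => simp
  | hadd a b ha hb => simp only [add_mul, map_add, ha, hb, ite_add_ite, add_zero]
  | hsmul t a ha => simp only [smul_mul_assoc, map_smul, ha, smul_ite, smul_zero]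

theorem leftDeriv_x (i j : Fin n) : leftDeriv i (x K j) = if j = i then 1 else 0 := by
  simpa using leftDeriv_x_mul i j (1 : Ass K n)

theorem partialDeriv_x (i j : Fin n) : partialDeriv i (x K j) = if j = i then 1 else 0 := by
  simpa using partialDeriv_mul_x i j (1 : Ass K n)

theorem leftDeriv_mul (i : Fin n) (a b : Ass K n) :
    leftDeriv i (a * b) = leftDeriv i a * b + FreeAlgebra.algebraMapInv a • leftDeriv i b := by
  induction a using word_induction with
  | hw l =>
    cases l with
    | nil => simp [word_nil, leftDeriv_one]
    | cons j l => simp [word_cons, mul_assoc, leftDeriv_x_mul, algebraMapInv_x]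
  | h0 => simp
  | hadd a a' h h' => simp only [add_mul, map_add, add_smul, h, h']; abel
  | hsmul t a h => simp only [smul_mul_assoc, map_smul, smul_assoc, h, smul_add]

theorem partialDeriv_mul (i : Fin n) (a b : Ass K n) :
    partialDeriv i (a * b)
      = a * partialDeriv i b + FreeAlgebra.algebraMapInv b • partialDeriv i a := by
  induction b using word_induction with
  | hw l =>
    rcases l.eq_nil_or_concat with rfl | ⟨l, j, rfl⟩
    · simp [word_nil, partialDeriv_one]
    · simp [word_concat, ← mul_assoc, partialDeriv_mul_x, algebraMapInv_x]
  | h0 => simp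
  | hadd b b' h h' => simp only [mul_add, map_add, add_smul, h, h']; abel
  | hsmul t b h => simp only [mul_smul_comm, map_smul, smul_assoc, h, smul_add]

theorem leftDeriv_partialDeriv (i j : Fin n) (a : Ass K n) :
    leftDeriv i (partialDeriv j a) = partialDeriv j (leftDeriv i a) := by
  induction a using word_induction with
  | hw l =>
    cases l with
    | nil => simp [word_nil, leftDeriv_one, partialDeriv_one]
    | cons k l =>
      rw [word_cons, partialDeriv_mul, partialDeriv_x, map_add, leftDeriv_x_mul, leftDeriv_x_mul,
        map_smul]
      split_ifs <;> simp [leftDeriv_one]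
  | h0 => simp
  | hadd a b ha hb => simp only [map_add, ha, hb]
  | hsmul t a ha => simp only [map_smul, ha]

theorem eventually_leftDeriv_pow_eq_zero (i : Fin n) (a : Ass K n) :
    ∀ᶠ N in atTop, (leftDeriv i ^ N) a = 0 := by
  induction a using word_induction with
  | hw l =>
    induction l with
    | nil =>
      filter_upwards [eventually_gt_atTop 0] with N hN
      rw [← Nat.sub_one_add_one hN.ne', pow_succ, Module.End.mul_apply, word_nil, leftDeriv_one,
        map_zero]
    | cons j l ih =>
      filter_upwards [eventually_gt_atTop 0, (tendsto_sub_atTop_nat 1).eventually ih] with N hN h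
      rw [← Nat.sub_one_add_one hN.ne', pow_succ, Module.End.mul_apply, word_cons,
        leftDeriv_x_mul]
      split_ifs
      · exact h
      · exact map_zero _
  | h0 => simp
  | hadd a b ha hb => filter_upwards [ha, hb] with N ha hb using by rw [map_add, ha, hb, add_zero]
  | hsmul t a ha => filter_upwards [ha] with N ha using by rw [map_smul, ha, smul_zero]

/-! ## The map `μ^f_gr` -/

theorem muGr_word (l : List (Fin n)) : muGr (word K l) = -∑ j : Fin (l.length - 1),
    word K (l.take j) * frakz K (l[j.1]'(by omega)) (l[j.1 + 1]'(by omega)) *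
      word K (l.drop (j + 2)) :=
  onWords_word _ _

theorem muGr_one : muGr (1 : Ass K n) = 0 := by
  simp [← word_nil, muGr_word]

theorem muGr_word_cons_cons (i j : Fin n) (l : List (Fin n)) :
    muGr (word K (i :: j :: l)) = x K i * muGr (word K (j :: l)) - frakz K i j * word K l := by
  rw [muGr_word, muGr_word, mul_neg, ← neg_add', neg_inj, Finset.mul_sum, add_comm]
  refine (Fin.sum_univ_succ (n := l.length) _).trans ?_
  simp [word_nil, word_cons, mul_assoc]

theorem muGr_x_mul (i : Fin n) (a : Ass K n) :
    muGr (x K i * a) = x K i * muGr a - x K i * leftDeriv i a := by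
  induction a using word_induction with
  | hw l =>
    cases l with
    | nil => simp [← word_cons, muGr_word, leftDeriv_word]
    | cons j l =>
      rw [← word_cons, muGr_word_cons_cons, word_cons j l, leftDeriv_x_mul]
      simp [frakz, eq_comm]
  | h0 => simp
  | hadd a b ha hb => simp only [mul_add, map_add, ha, hb]; abel
  | hsmul t a ha => simp only [mul_smul_comm, map_smul, ha, smul_sub]

theorem muGr_mul (a b : Ass K n) :
    muGr (a * b) = muGr a * b + a * muGr b - ∑ i, partialDeriv i a * x K i * leftDeriv i b := by
  induction a using word_induction with
  | hw l =>
    induction l with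
    | nil => simp [word_nil, muGr_one, partialDeriv_one]
    | cons j l ih =>
      have junction : ∑ i, partialDeriv i (word K (j :: l)) * x K i * leftDeriv i b
          = x K j * ∑ i, partialDeriv i (word K l) * x K i * leftDeriv i b
            + FreeAlgebra.algebraMapInv (word K l) • (x K j * leftDeriv j b) := by
        simp [word_cons, partialDeriv_mul, partialDeriv_x, add_mul, Finset.sum_add_distrib,
          Finset.mul_sum, mul_assoc]
      rw [junction, word_cons, mul_assoc, muGr_x_mul, muGr_x_mul, ih, leftDeriv_mul]
      simp only [mul_add, mul_sub, sub_mul, mul_assoc, mul_smul_comm]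
      abel
  | h0 => simp
  | hadd a a' h h' => simp only [add_mul, map_add, h, h', Finset.sum_add_distrib]; abel
  | hsmul t a h =>
    simp only [smul_mul_assoc, map_smul, h, smul_add, smul_sub, Finset.smul_sum]

theorem muGr_mul_x (i : Fin n) (a : Ass K n) :
    muGr (a * x K i) = muGr a * x K i - partialDeriv i a * x K i := by
  have muGr_x : muGr (x K i) = 0 := by
    simpa [muGr_one, leftDeriv_one] using muGr_x_mul i (1 : Ass K n)
  simp [muGr_mul, muGr_x, leftDeriv_x]

/-! ## Linear forms and their centralizers -/

/-- The element `∑ i, t_i x_i` of degree one; it covers `x_0` and `x_1, …, x_n` alike. -/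
noncomputable def linearForm (t : Fin n → K) : Ass K n := ∑ i, t i • x K i

theorem leftDeriv_linearForm_mul (t : Fin n → K) (i : Fin n) (a : Ass K n) :
    leftDeriv i (linearForm t * a) = t i • a := by
  simp [linearForm, Finset.sum_mul, leftDeriv_x_mul]

theorem leftDeriv_mul_linearForm (t : Fin n → K) (i : Fin n) (a : Ass K n) :
    leftDeriv i (a * linearForm t)
      = leftDeriv i a * linearForm t + (t i * FreeAlgebra.algebraMapInv a) • 1 := by
  simp [leftDeriv_mul, linearForm, leftDeriv_x, smul_smul, mul_comm]

theorem partialDeriv_mul_linearForm (t : Fin n → K) (i : Fin n) (a : Ass K n) :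
    partialDeriv i (a * linearForm t) = t i • a := by
  simp [linearForm, Finset.mul_sum, partialDeriv_mul_x]

theorem mul_linearForm_right_injective {t : Fin n → K} (ht : t ≠ 0) :
    Function.Injective fun a : Ass K n => a * linearForm t := by
  obtain ⟨i, hi⟩ := Function.ne_iff.mp ht
  intro a b hab
  have h := congrArg (partialDeriv i) hab
  simp only [partialDeriv_mul_linearForm] at h
  exact smul_right_injective _ hi h

theorem exists_aeval_eq_of_commute_linearForm {t : Fin n → K} (ht : t ≠ 0) {c : Ass K n}
    (h : Commute (linearForm t) c) : ∃ p : K[X], aeval (linearForm t) p = c := by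
  obtain ⟨i, hi⟩ := Function.ne_iff.mp ht
  obtain ⟨N, hN⟩ := (eventually_leftDeriv_pow_eq_zero i c).exists
  induction N generalizing c with
  | zero => exact ⟨0, by simpa using hN.symm⟩
  | succ N ih =>
    let d := (t i)⁻¹ • leftDeriv i c
    let ε : K := FreeAlgebra.algebraMapInv c
    have hc : c = d * linearForm t + ε • 1 := by
      refine smul_right_injective _ hi ?_
      calc t i • c = leftDeriv i (linearForm t * c) := (leftDeriv_linearForm_mul t i c).symm
        _ = leftDeriv i (c * linearForm t) := by rw [h.eq]
        _ = leftDeriv i c * linearForm t + (t i * ε) • 1 := leftDeriv_mul_linearForm t i c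
        _ = t i • (d * linearForm t + ε • 1) := by
          rw [smul_add, smul_smul, smul_mul_assoc, smul_inv_smul₀ hi]
    have hd : Commute (linearForm t) d := by
      refine mul_linearForm_right_injective ht ?_
      have h' := h.eq
      rw [hc, mul_add, add_mul, mul_smul_one, smul_one_mul] at h'
      simpa only [mul_assoc] using add_right_cancel h'
    have hN' : (leftDeriv i ^ N) d = 0 := by
      rw [map_smul, ← Module.End.mul_apply, ← pow_succ, hN, smul_zero]
    obtain ⟨p, hp⟩ := ih hd hN'
    exact ⟨p * X + C ε, by simpa [hp, Algebra.algebraMap_eq_smul_one] using hc.symm⟩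

/-! ## Contraction of adjacent letters and cyclic rotation -/

theorem tr_mul_comm (a b : Ass K n) : tr (a * b) = tr (b * a) := by
  rw [← sub_eq_zero, ← map_sub]
  exact (Submodule.Quotient.mk_eq_zero _).mpr (Submodule.subset_span ⟨a, b, rfl⟩)

theorem trComp_tr (k : ℕ) (a : Ass K n) : trComp k (tr a) = tr (assComp k a) := rfl

theorem assComp_word (k : ℕ) (l : List (Fin n)) :
    assComp k (word K l) = if l.length = k then word K l else 0 :=
  onWords_word _ _

/-- The cyclic rotation of words, which moves the first letter to the end. -/
noncomputable def rotation : Ass K n →ₗ[K] Ass K n := onWords fun l => word K (l.rotate 1)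

theorem rotation_word (l : List (Fin n)) : rotation (word K l) = word K (l.rotate 1) :=
  onWords_word _ _

theorem rotation_pow_word (j : ℕ) (l : List (Fin n)) :
    (rotation ^ j) (word K l) = word K (l.rotate j) := by
  induction j with
  | zero => simp
  | succ j ih => rw [pow_succ', Module.End.mul_apply, ih, rotation_word, List.rotate_rotate]

theorem rotation_x_mul (i : Fin n) (a : Ass K n) : rotation (x K i * a) = a * x K i := by
  induction a using word_induction with
  | hw l => simp [← word_cons, ← word_concat, rotation_word]
  | h0 => simp
  | hadd a b ha hb => simp only [mul_add, add_mul, map_add, ha, hb]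
  | hsmul t a ha => simp only [mul_smul_comm, smul_mul_assoc, map_smul, ha]

/-- The cyclic word obtained by contracting the first two letters with `𝔷`: its values on the
rotations of a word are the terms of `-|μ^f_gr|` and one more, for the last and the first letter. -/
noncomputable def contraction : Ass K n →ₗ[K] Tr K n :=
  tr ∘ₗ ∑ i, LinearMap.mulLeft K (x K i) ∘ₗ leftDeriv i ∘ₗ leftDeriv i

theorem contraction_x_mul (i : Fin n) (a : Ass K n) :
    contraction (x K i * a) = tr (x K i * leftDeriv i a) := by
  simp [contraction, leftDeriv_x_mul, apply_ite]

theorem contraction_word_cons_cons (i j : Fin n) (l : List (Fin n)) :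
    contraction (word K (i :: j :: l)) = tr (frakz K i j * word K l) := by
  rw [word_cons, contraction_x_mul, word_cons, leftDeriv_x_mul]
  simp [frakz, eq_comm]

theorem trComp_contraction_word (k : ℕ) (l : List (Fin n)) :
    trComp k (contraction (word K l))
      = if l.length = k + 1 then contraction (word K l) else 0 := by
  match l with
  | [] => simp [contraction, word_nil, leftDeriv_one]
  | [i] => simp [word_cons, word_nil, contraction, leftDeriv_x, apply_ite, leftDeriv_one]
  | i :: j :: l =>
    rw [contraction_word_cons_cons, frakz]
    split_ifs <;> simp_all [trComp_tr, ← word_cons, assComp_word]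

theorem tr_muGr_word (l : List (Fin n)) : tr (muGr (word K l))
    = -∑ j ∈ Finset.range (l.length - 1), contraction ((rotation ^ j) (word K l)) := by
  rw [muGr_word, map_neg, map_sum, ← Fin.sum_univ_eq_sum_range
    (fun j => contraction ((rotation ^ j) (word K l)))]
  congr 1
  refine Finset.sum_congr rfl fun j _ => ?_
  have hj := j.2
  rw [rotation_pow_word, List.rotate_eq_drop_append_take (by omega),
    List.drop_eq_getElem_cons (i := j.1) (by omega),
    List.drop_eq_getElem_cons (i := j.1 + 1) (by omega),
    List.cons_append, List.cons_append, contraction_word_cons_cons, mul_assoc, tr_mul_comm,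
    mul_assoc, word_mul]

theorem trComp_tr_muGr (k : ℕ) (a : Ass K n) : trComp k (tr (muGr a))
    = -∑ j ∈ Finset.range k, trComp k (contraction ((rotation ^ j) a)) := by
  induction a using word_induction with
  | hw l =>
    simp only [tr_muGr_word, map_neg, map_sum, rotation_pow_word, trComp_contraction_word,
      List.length_rotate]
    by_cases h : l.length = k + 1 <;> simp [h]
  | h0 => simp
  | hadd a b ha hb => simp only [map_add, ha, hb, Finset.sum_add_distrib, neg_add]
  | hsmul t a ha => simp only [map_smul, ha, Finset.smul_sum, smul_neg]

theorem trComp_tr_muGr_of_rotation_eq (k : ℕ) {a : Ass K n} (ha : rotation a = a) :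
    trComp k (tr (muGr a)) = -((k : K) • trComp k (contraction a)) := by
  have ha_pow (j : ℕ) : (rotation ^ j) a = a := by
    rw [Module.End.pow_apply]
    exact Function.iterate_fixed ha j
  simp [trComp_tr_muGr, ha_pow, Nat.cast_smul_eq_nsmul]

/-! ## Homogeneous components -/

theorem assComp_zero_x_mul (i : Fin n) (a : Ass K n) : assComp 0 (x K i * a) = 0 := by
  induction a using word_induction with
  | hw l => simp [← word_cons, assComp_word]
  | h0 => simp
  | hadd a b ha hb => simp only [mul_add, map_add, ha, hb, add_zero]
  | hsmul t a ha => simp only [mul_smul_comm, map_smul, ha, smul_zero]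

theorem assComp_succ_x_mul (k : ℕ) (i : Fin n) (a : Ass K n) :
    assComp (k + 1) (x K i * a) = x K i * assComp k a := by
  induction a using word_induction with
  | hw l => simp [← word_cons, assComp_word]
  | h0 => simp
  | hadd a b ha hb => simp only [mul_add, map_add, ha, hb]
  | hsmul t a ha => simp only [mul_smul_comm, map_smul, ha]

theorem assComp_linearForm_pow (t : Fin n → K) (k m : ℕ) :
    assComp k (linearForm t ^ m) = if m = k then linearForm t ^ m else 0 := by
  induction m generalizing k with
  | zero => simp [← word_nil, assComp_word]
  | succ m ih =>
    cases k with
    | zero => simp [pow_succ', linearForm, Finset.sum_mul, assComp_zero_x_mul]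
    | succ k =>
      have h : assComp (k + 1) (linearForm t * linearForm t ^ m)
          = linearForm t * assComp k (linearForm t ^ m) := by
        simp [linearForm, Finset.sum_mul, assComp_succ_x_mul]
      simp [pow_succ', h, ih]

theorem trComp_tr_aeval_linearForm (t : Fin n → K) (k : ℕ) (p : K[X]) :
    trComp k (tr (aeval (linearForm t) p)) = p.coeff k • tr (linearForm t ^ k) := by
  induction p using Polynomial.induction_on' with
  | add p q hp hq => simp only [map_add, hp, hq, coeff_add, add_smul]
  | monomial m a =>
    rw [aeval_monomial, ← Algebra.smul_def, map_smul, map_smul, trComp_tr,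
      assComp_linearForm_pow, coeff_monomial]
    split_ifs with h <;> simp [h]

theorem toCompletion_tr_aeval_linearForm (t : Fin n → K) (p : K[X]) :
    toCompletion (tr (aeval (linearForm t) p)) = trSeries (p : PowerSeries K) (linearForm t) := by
  funext k
  rw [toCompletion, trSeries, trComp_tr_aeval_linearForm, coeff_coe]

theorem natCast_smul_trComp_tr_aeval_linearForm (t : Fin n → K) (k : ℕ) (p : K[X]) :
    (k : K) • trComp k (tr (aeval (linearForm t) p))
      = trComp k (tr (linearForm t * aeval (linearForm t) (derivative p))) := by
  have h : linearForm t * aeval (linearForm t) (derivative p)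
      = aeval (linearForm t) (X * derivative p) := by
    rw [map_mul, aeval_X]
  rw [h, trComp_tr_aeval_linearForm, trComp_tr_aeval_linearForm, smul_smul]
  cases k with
  | zero => simp
  | succ k => rw [coeff_X_mul, coeff_derivative, mul_comm, Nat.cast_succ]

theorem eventually_sum_trComp_eq (t : Tr K n) :
    ∀ᶠ N in atTop, ∑ k ∈ Finset.range N, trComp k t = t := by
  obtain ⟨a, rfl⟩ := (commSpan K n).mkQ_surjective t
  change ∀ᶠ N in atTop, ∑ k ∈ Finset.range N, trComp k (tr a) = tr a
  induction a using word_induction with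
  | hw l =>
    filter_upwards [eventually_gt_atTop l.length] with N hN
    simp [trComp_tr, assComp_word, apply_ite, hN]
  | h0 => simp
  | hadd a b ha hb =>
    filter_upwards [ha, hb] with N ha hb
    simp only [map_add, Finset.sum_add_distrib, ha, hb]
  | hsmul t a ha =>
    filter_upwards [ha] with N ha
    simp only [map_smul, ← Finset.smul_sum, ha]

theorem toCompletion_injective : Function.Injective (toCompletion (K := K) (n := n)) := by
  intro s t h
  obtain ⟨N, hs, ht⟩ := ((eventually_sum_trComp_eq s).and (eventually_sum_trComp_eq t)).exists
  rw [← hs, ← ht]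
  exact Finset.sum_congr rfl fun k _ => congrFun h k

theorem eq_of_natCast_smul_trComp_eq [CharZero K] {s t : Tr K n} (h0 : trComp 0 s = trComp 0 t)
    (h : ∀ k : ℕ, (k : K) • trComp k s = (k : K) • trComp k t) : s = t := by
  refine toCompletion_injective (funext fun k => ?_)
  obtain rfl | hk := eq_or_ne k 0
  · exact h0
  · exact smul_right_injective _ (Nat.cast_ne_zero.mpr hk) (h k)

theorem exists_derivative_eq [CharZero K] (p : K[X]) :
    ∃ f : K[X], f.coeff 0 = 0 ∧ derivative f = p := by
  induction p using Polynomial.induction_on' with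
  | add p q hp hq =>
    obtain ⟨f, hf, rfl⟩ := hp
    obtain ⟨g, hg, rfl⟩ := hq
    exact ⟨f + g, by simp [hf, hg], derivative_add⟩
  | monomial k a =>
    refine ⟨monomial (k + 1) (a / (k + 1)), coeff_monomial_of_ne _ k.succ_ne_zero.symm, ?_⟩
    rw [derivative_monomial_succ, div_mul_cancel₀ _ k.cast_add_one_ne_zero]

/-! ## The elements `x_0, …, x_n` -/

variable (K n) in
/-- The coefficients of `x_0, …, x_n` as linear forms in `x_1, …, x_n`. -/
def xExtCoeff : Fin (n + 1) → Fin n → K := Fin.cons 1 fun i => Pi.single i 1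

theorem xExt_eq_linearForm (i : Fin (n + 1)) : xExt K n i = linearForm (xExtCoeff K n i) := by
  induction i using Fin.cases with
  | zero => simp [linearForm, xExt, xExtCoeff]
  | succ i => simp [linearForm, xExt, xExtCoeff, Pi.single_apply]

theorem xExtCoeff_ne_zero [NeZero n] (i : Fin (n + 1)) : xExtCoeff K n i ≠ 0 :=
  Fin.cases one_ne_zero (fun j => by simp [xExtCoeff]) i

theorem exists_aeval_eq_of_commute_xExt [NeZero n] {i : Fin (n + 1)} {c : Ass K n}
    (h : Commute (xExt K n i) c) : ∃ p : K[X], aeval (xExt K n i) p = c := by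
  rw [xExt_eq_linearForm] at h ⊢
  exact exists_aeval_eq_of_commute_linearForm (xExtCoeff_ne_zero i) h

/-! ## Tuples annihilating `x_0` -/

section

variable {U : Fin n → Ass K n} (hU : ∑ i, x K i * U i = ∑ i, U i * x K i)

include hU

theorem leftDeriv_eq_partialDeriv (i : Fin n) : leftDeriv i (U i) = partialDeriv i (U i) := by
  have left : leftDeriv i (∑ j, x K j * U j) = U i := by simp [leftDeriv_x_mul]
  have right : partialDeriv i (∑ j, x K j * U j) = U i := by simp [hU, partialDeriv_mul_x]
  calc leftDeriv i (U i) = leftDeriv i (partialDeriv i (∑ j, x K j * U j)) := by rw [right]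
    _ = partialDeriv i (U i) := by rw [leftDeriv_partialDeriv, left]

theorem contraction_sum_x_mul :
    contraction (∑ i, x K i * U i) = ∑ i, tr (x K i * partialDeriv i (U i)) := by
  simp only [map_sum, contraction_x_mul, leftDeriv_eq_partialDeriv hU]

theorem natCast_smul_trComp_sum_tr (k : ℕ) :
    (k : K) • trComp k (∑ i, tr (x K i * partialDeriv i (U i)))
      = -trComp k (tr (muGr (∑ i, x K i * U i))) := by
  have rotation_eq : rotation (∑ i, x K i * U i) = ∑ i, x K i * U i := by
    conv_rhs => rw [hU]
    simp only [map_sum, rotation_x_mul]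
  rw [trComp_tr_muGr_of_rotation_eq k rotation_eq, contraction_sum_x_mul hU, neg_neg]

theorem exists_muGr_sum_x_mul_eq [NeZero n] {c : Ass K n}
    (hc : ∀ i, muGr (x K i * U i - U i * x K i) = x K i * c - c * x K i) :
    ∃ p : Fin (n + 1) → K[X],
      muGr (∑ i, x K i * U i) = ∑ i, xExt K n i * aeval (xExt K n i) (p i) := by
  let w (i : Fin n) : Ass K n := muGr (U i) - partialDeriv i (U i) - c
  have muGr_left (i : Fin n) : muGr (x K i * U i) = x K i * c + x K i * w i := by
    rw [muGr_x_mul, leftDeriv_eq_partialDeriv hU, ← mul_sub, ← mul_add, add_sub_cancel]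
  have muGr_right (i : Fin n) : muGr (U i * x K i) = c * x K i + w i * x K i := by
    rw [muGr_mul_x, ← sub_mul, ← add_mul, add_sub_cancel]
  have commute_w (i : Fin n) : Commute (x K i) (w i) := by
    have h := hc i
    rw [map_sub, muGr_left, muGr_right, add_sub_add_comm, add_eq_left] at h
    exact sub_eq_zero.mp h
  have commute_c : Commute (∑ i, x K i) c := by
    have h := congrArg muGr hU
    simp only [map_sum, muGr_left, muGr_right, Finset.sum_add_distrib, (commute_w _).eq,
      ← Finset.sum_mul, ← Finset.mul_sum] at h
    exact add_right_cancel h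
  have commute_xExt (i : Fin (n + 1)) :
      Commute (xExt K n i) ((Fin.cons c w : Fin (n + 1) → Ass K n) i) :=
    Fin.cases commute_c commute_w i
  choose p hp using fun i => exists_aeval_eq_of_commute_xExt (commute_xExt i)
  refine ⟨p, ?_⟩
  simp only [hp]
  simp only [Fin.sum_univ_succ, xExt, Fin.cons_zero, Fin.cons_succ, map_sum, muGr_left,
    Finset.sum_add_distrib, Finset.sum_mul]

end

section

attribute [local instance] LieRing.ofAssociativeRing

theorem toAss_rho_of (u : Tder K n) (i : Fin n) :
    toAss K n (rho u (FreeLieAlgebra.of K i))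
      = x K i * toAss K n (u i) - toAss K n (u i) * x K i := by
  have toAss_of : toAss K n (FreeLieAlgebra.of K i) = x K i := by simp [toAss]
  rw [rho_of, LieHom.map_lie, toAss_of, LieRing.of_associative_ring_bracket]

theorem sum_x_mul_toAss_eq {u : Tder K n} (hu : u ∈ sder K n) :
    ∑ i, x K i * toAss K n (u i) = ∑ i, toAss K n (u i) * x K i := by
  have h := congrArg (toAss K n) (show rho u (∑ i, FreeLieAlgebra.of K i) = 0 from hu)
  simpa only [map_sum, toAss_rho_of, map_zero, Finset.sum_sub_distrib, sub_eq_zero] using h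

end

theorem mem_krv_of_divergence_eq {u : Tder K n} (hu : u ∈ sder K n) {f : Fin (n + 1) → K[X]}
    (hf : divergence u = ∑ i, tr (aeval (xExt K n i) (f i))) : u ∈ krv K n := by
  refine ⟨hu, fun i => f i, ?_⟩
  simp only [hf, xExt_eq_linearForm, ← toCompletion_tr_aeval_linearForm]
  funext k
  simp only [toCompletion, map_sum, Finset.sum_apply]

end KV

open KV in
theorem proposition6p2_general {K : Type*} [Field K] [CharZero K] {n : ℕ} {U : Fin n → Ass K n}
    (hU : ∑ i, x K i * U i = ∑ i, U i * x K i) {c : Ass K n}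
    (hc : ∀ i, muGr (x K i * U i - U i * x K i) = x K i * c - c * x K i) :
    ∃ f : Fin (n + 1) → Polynomial K,
      ∑ i, tr (x K i * partialDeriv i (U i))
        = ∑ i, tr (Polynomial.aeval (xExt K n i) (f i)) := by
  obtain rfl | _ := eq_zero_or_neZero n
  · exact ⟨0, by simp⟩
  obtain ⟨p, hp⟩ := exists_muGr_sum_x_mul_eq hU hc
  choose f hf0 hf using fun i => exists_derivative_eq (-p i)
  refine ⟨f, eq_of_natCast_smul_trComp_eq ?_ fun k => ?_⟩
  · simp only [map_sum, trComp_tr, assComp_zero_x_mul, map_zero, Finset.sum_const_zero]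
    simp [← trComp_tr, xExt_eq_linearForm, trComp_tr_aeval_linearForm, hf0]
  · rw [natCast_smul_trComp_sum_tr hU, hp]
    simp only [map_sum, Finset.smul_sum, xExt_eq_linearForm,
      natCast_smul_trComp_tr_aeval_linearForm, hf, map_neg, mul_neg, Finset.sum_neg_distrib]

theorem proposition6p2 {K : Type*} [Field K] [CharZero K] {n : ℕ}
    (u : KV.Tder K n) (hu : u ∈ KV.sder K n)
    (hc : ∃ c : KV.Ass K n, ∀ i : Fin n,
      KV.muGr (KV.toAss K n (KV.rho u (FreeLieAlgebra.of K i))) =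
        KV.x K i * c - c * KV.x K i) :
    u ∈ KV.krv K n := by
  obtain ⟨c, hc⟩ := hc
  simp only [KV.toAss_rho_of] at hc
  obtain ⟨f, hf⟩ := proposition6p2_general (KV.sum_x_mul_toAss_eq hu) hc
  exact KV.mem_krv_of_divergence_eq hu hf
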